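/- Let $p$ be an odd prime and let $F$ be a field of characteristic $p$. Let $\mathfrak b_2(F)$ be the $F$-vector space generated by symbols $\langle a\rangle$, $a\in F\setminus\{0,1\}$, subject to the relations $$\langle a\rangle-\langle b\rangle+a\left\langle \frac{b}{a}\right\rangle+(1-a)\left\langle\frac{1-b}{1-a}\right\rangle=0$$ for all $a,b\in F\setminus\{0,1\}$ with $a\neq b$. Then $\dim_F \mathfrak b_2(F)\geq 1$. If, moreover, $F$ is perfect, then $\mathfrak b_2(F)\cong F$ as $F$-vector spaces. -/

import Mathlib

/-- The doubly punctured affine line `F - {0, 1}`. -/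
abbrev DoublyPunctured (F : Type*) [Field F] : Type _ := {x : F // x ≠ 0 ∧ x ≠ 1}

namespace DoublyPunctured

/-- `b / a`, for distinct `a`, `b` in `F - {0, 1}`. -/
def quot {F : Type*} [Field F] (a b : DoublyPunctured F) (h : a ≠ b) : DoublyPunctured F :=
  ⟨(b : F) / (a : F), div_ne_zero b.2.1 a.2.1, fun e =>
    h (Subtype.ext ((div_eq_one_iff_eq a.2.1).1 e).symm)⟩

/-- `(1 - b) / (1 - a)`, for distinct `a`, `b` in `F - {0, 1}`. -/
def coquot {F : Type*} [Field F] (a b : DoublyPunctured F) (h : a ≠ b) : DoublyPunctured F :=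
  ⟨(1 - (b : F)) / (1 - (a : F)),
    div_ne_zero (sub_ne_zero.2 b.2.2.symm) (sub_ne_zero.2 a.2.2.symm), fun e =>
    h (Subtype.ext (sub_right_injective
      ((div_eq_one_iff_eq (sub_ne_zero.2 a.2.2.symm)).1 e)).symm)⟩

end DoublyPunctured

/-- The four-term element `[a] - [b] + a [b/a] + (1 - a) [(1-b)/(1-a)]` of the free `F`-vector
space on `F - {0, 1}`. -/
noncomputable def fourTerm {F : Type*} [Field F] (a b : DoublyPunctured F) (h : a ≠ b) :
    DoublyPunctured F →₀ F :=
  Finsupp.single a 1 - Finsupp.single b 1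
    + (a : F) • Finsupp.single (DoublyPunctured.quot a b h) 1
    + (1 - (a : F)) • Finsupp.single (DoublyPunctured.coquot a b h) 1

/-- The `F`-subspace spanned by all four-term elements. -/
noncomputable def fourTermRelations (F : Type*) [Field F] : Submodule F (DoublyPunctured F →₀ F) :=
  Submodule.span F {r | ∃ (a b : DoublyPunctured F) (h : a ≠ b), r = fourTerm a b h}

/-- The `F`-vector space `𝔟₂(F)`: generators `⟨a⟩` for `a` in `F - {0, 1}`, subject to the
four-term relations. -/
abbrev B2 (F : Type*) [Field F] : Type _ := (DoublyPunctured F →₀ F) ⧸ fourTermRelations F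

/-! ### Solutions of the four-term equation and the cocycles they define -/

/-! Upper bound: a solution `f` of the four-term equation gives a homogeneous symmetric cocycle `(x
+ y) • f (x / (x + y))`, hence an extension `E` of `F` by `V` on which `F` acts through a
multiplicative map `ρ`. The defect `ρ u + ρ v - ρ (u + v)` squares to zero. If `p` kills `E`,
Frobenius on commuting endomorphisms makes the defect at `(u ^ p, v ^ p)` the `p`-th power of the
one at `(u, v)`, hence zero. Over a perfect field `ρ` is then additive and `f = 0`
(`IsFourTermSolution.eq_zero`). The obstruction to `p E = 0` is a single vector of `V`, so its class
spans `𝔟₂(F)`.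

Lower bound: the `p`-th root of `(1 - a ^ p - (1 - a) ^ p) / p`, the quotient being formed over `ℤ`,
is a solution with values in the algebraic closure (`frobeniusDefect_four_term`). It is nonzero,
since otherwise `n ^ p ≡ n` modulo `p ^ 2` for every natural number `n`. -/

/-- `f : F → V` solves the four-term equation on all of `F`, vanishes at `0`, and satisfies the
reflection and inversion formulas. -/
structure IsFourTermSolution {F V : Type*} [Field F] [AddCommGroup V] [Module F V]
    (f : F → V) : Prop where
  zero : f 0 = 0
  one_sub : ∀ a, f (1 - a) = f a
  inv : ∀ a, a • f a⁻¹ = -f a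
  fourTerm : ∀ a b, f a - f b + a • f (b / a) + (1 - a) • f ((1 - b) / (1 - a)) = 0

/-- A function solving the four-term equation on `F - {0, 1}` and vanishing at `0` and `1`
solves it everywhere, and satisfies the reflection and inversion formulas. -/
theorem IsFourTermSolution.of_generic {F V : Type*} [Field F] [AddCommGroup V] [Module F V]
    (h2 : (2 : F) ≠ 0) {f : F → V} (f0 : f 0 = 0) (f1 : f 1 = 0)
    (hf : ∀ a b, a ≠ 0 → a ≠ 1 → b ≠ 0 → b ≠ 1 → a ≠ b →
      f a - f b + a • f (b / a) + (1 - a) • f ((1 - b) / (1 - a)) = 0) :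
    IsFourTermSolution f := by
  have half : ∀ v : V, v = -v → v = 0 := fun v hv => by
    have : (2 : F) • v = 0 := by rw [two_smul]; nth_rw 2 [hv]; simp
    exact (smul_eq_zero.1 this).resolve_left h2
  have refl : ∀ a, f (1 - a) = f a := by
    intro a
    by_cases a0 : a = 0
    · simp [a0, f0, f1]
    by_cases a1 : a = 1
    · simp [a1, f0, f1]
    by_cases ha : a = 1 - a
    · rw [← ha]
    -- Exchanging `a` and `1 - a` only permutes the two scaled terms, so subtracting gives `2 (f a -
    -- f (1 - a)) = 0`.
    have e1 := hf a (1 - a) a0 a1 (sub_ne_zero.2 (Ne.symm a1)) (by simpa using a0) ha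
    have e2 := hf (1 - a) a (sub_ne_zero.2 (Ne.symm a1)) (by simpa using a0) a0 a1 (Ne.symm ha)
    simp only [sub_sub_cancel] at e1 e2
    have : f (1 - a) - f a = -(f (1 - a) - f a) := by
      have e3 : f a - f (1 - a) = f (1 - a) - f a := by
        rw [← sub_eq_zero, ← sub_eq_zero.2 (e1.trans e2.symm)]; abel
      rw [neg_sub, e3]
    exact sub_eq_zero.1 (half _ this)
  have inv : ∀ y, y • f y⁻¹ = -f y := by
    intro y
    by_cases y0 : y = 0
    · simp [y0, f0]
    by_cases y1 : y = 1
    · simp [y1, f1]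
    by_cases ym : y = -1
    · subst ym; simp [inv_neg]
    have hy : 1 + y ≠ 0 := fun h => ym (by linear_combination h)
    -- Chosen so that `(1 - a) / a = y`; by reflection the relation at `(a, 1 - a)` keeps only its
    -- two scaled terms.
    set a : F := (1 + y)⁻¹ with ha
    have a0 : a ≠ 0 := inv_ne_zero hy
    have hya : y = (1 - a) / a := by rw [ha]; field_simp; ring
    have a1 : a ≠ 1 := fun h => y0 (by rw [hya, h]; simp)
    have a1' : 1 - a ≠ 0 := sub_ne_zero.2 (Ne.symm a1)
    have hne : a ≠ 1 - a := fun h => y1 (by rw [hya, ← h, div_self a0])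
    have hyi : y⁻¹ = a / (1 - a) := by rw [hya, inv_div]
    have e1 := hf a (1 - a) a0 a1 a1' (by simpa using a0) hne
    rw [refl a] at e1
    simp only [sub_sub_cancel, sub_self, zero_add] at e1
    rw [← hya, ← hyi] at e1
    have : a • (f y + y • f y⁻¹) = 0 := by
      rw [smul_add, smul_smul, show a * y = 1 - a by rw [hya]; field_simp, e1]
    exact eq_neg_of_add_eq_zero_right ((smul_eq_zero.1 this).resolve_left a0)
  refine ⟨f0, refl, inv, fun a b => ?_⟩
  by_cases a0 : a = 0
  · simp [a0, f0, refl]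
  by_cases a1 : a = 1
  · simp [a1, f1]
  by_cases b0 : b = 0
  · simp [b0, f0, inv, refl]
  by_cases b1 : b = 1
  · simp [b1, f0, f1, inv]
  by_cases hab : a = b
  · subst hab
    rw [div_self a0, div_self (sub_ne_zero.2 (Ne.symm a1))]
    simp [f1]
  exact hf a b a0 a1 b0 b1 hab

/-- The homogeneous function of two variables attached to `f`. -/
def homogenize {F V : Type*} [Field F] [AddCommGroup V] [Module F V] (f : F → V) (x y : F) : V :=
  (x + y) • f (x / (x + y))

theorem homogenize_neg_self {F V : Type*} [Field F] [AddCommGroup V] [Module F V]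
    (f : F → V) (x : F) : homogenize f (-x) x = 0 := by
  simp [homogenize]

theorem homogenize_mul {F V : Type*} [Field F] [AddCommGroup V] [Module F V]
    (f : F → V) (t x y : F) :
    homogenize f (t * x) (t * y) = t • homogenize f x y := by
  unfold homogenize
  by_cases h : t = 0
  · simp [h]
  · rw [← mul_add, mul_div_mul_left _ _ h, mul_smul]

namespace IsFourTermSolution

variable {F V : Type*} [Field F] [AddCommGroup V] [Module F V] {f : F → V}

theorem homogenize_zero_left (hf : IsFourTermSolution f) (x : F) : homogenize f 0 x = 0 := by
  simp [homogenize, hf.zero]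

theorem homogenize_comm (hf : IsFourTermSolution f) (x y : F) :
    homogenize f x y = homogenize f y x := by
  unfold homogenize
  rw [add_comm y x]
  by_cases h : x + y = 0
  · simp [h]
  · rw [← hf.one_sub, show 1 - x / (x + y) = y / (x + y) by field_simp; ring]

theorem smul_inv_div (hf : IsFourTermSolution f) (x y : F) :
    x • f (y / x) = -(y • f (x / y)) := by
  by_cases hx : x = 0
  · simp [hx, hf.zero]
  by_cases hy : y = 0
  · simp [hy, hf.zero]
  have := hf.inv (y / x)
  rw [inv_div] at this
  rw [← neg_eq_iff_eq_neg.2 this, smul_neg, smul_smul, mul_div_cancel₀ _ hx]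

/-- With `s = x + y + z` nonzero, this is `s` times the four-term equation at `((x + y) / s, x /
s)`. For `s = 0` it reduces to reflection and inversion. -/
theorem homogenize_cocycle (hf : IsFourTermSolution f) (x y z : F) :
    homogenize f x y + homogenize f (x + y) z = homogenize f x (y + z) + homogenize f y z := by
  by_cases hs : x + y + z = 0
  · have hz : z = -(x + y) := by linear_combination hs
    subst hz
    have h1 : y + -(x + y) = -x := by ring
    simp only [homogenize, h1, add_neg_cancel, zero_smul, zero_add, add_zero]
    rw [hf.smul_inv_div, neg_smul, ← hf.one_sub]
    by_cases hx : x = 0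
    · simp [hx]
    · rw [show 1 - (x + y) / x = y / -x by field_simp; ring]
  · have h := hf.fourTerm ((x + y) / (x + y + z)) (x / (x + y + z))
    have h1 : 1 - (x + y) / (x + y + z) = z / (x + y + z) := by field_simp; ring
    have h2 : 1 - x / (x + y + z) = (y + z) / (x + y + z) := by field_simp; ring
    rw [h1, h2, div_div_div_cancel_right₀ hs, div_div_div_cancel_right₀ hs] at h
    have h' := congrArg (fun v => (x + y + z) • v) h
    simp only [smul_add, smul_sub, smul_smul, mul_div_cancel₀ _ hs, smul_zero] at h'
    have h3 : z • f ((y + z) / z) = -homogenize f y z := by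
      rw [hf.smul_inv_div, hf.homogenize_comm, homogenize, add_comm z y]
    rw [h3] at h'
    unfold homogenize at h' ⊢
    rw [← add_assoc x y z, ← sub_eq_zero, ← h']
    abel

end IsFourTermSolution

/-! ### The extension of `F` by `V` and its multiplicative `F`-action -/

/-- The extension of the additive group `F` by `V` with cocycle `homogenize f`. -/
@[ext]
structure CocycleExtension {F V : Type*} (f : F → V) where
  fiber : V
  base : F

namespace CocycleExtension

section

variable {F V : Type*} [Field F] [AddCommGroup V] {f : F → V}

instance : Zero (CocycleExtension f) := ⟨⟨0, 0⟩⟩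

instance : Neg (CocycleExtension f) := ⟨fun m => ⟨-m.fiber, -m.base⟩⟩

@[simp] theorem fiber_zero : (0 : CocycleExtension f).fiber = 0 := rfl

@[simp] theorem base_zero : (0 : CocycleExtension f).base = 0 := rfl

@[simp] theorem fiber_neg (m : CocycleExtension f) : (-m).fiber = -m.fiber := rfl

@[simp] theorem base_neg (m : CocycleExtension f) : (-m).base = -m.base := rfl

end

variable {F V : Type*} [Field F] [AddCommGroup V] [Module F V] {f : F → V}

instance : Add (CocycleExtension f) :=
  ⟨fun m n => ⟨m.fiber + n.fiber + homogenize f m.base n.base, m.base + n.base⟩⟩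

@[simp] theorem fiber_add (m n : CocycleExtension f) :
    (m + n).fiber = m.fiber + n.fiber + homogenize f m.base n.base := rfl

@[simp] theorem base_add (m n : CocycleExtension f) : (m + n).base = m.base + n.base := rfl

/-- The group structure on the extension. -/
abbrev addCommGroup (hf : IsFourTermSolution f) : AddCommGroup (CocycleExtension f) :=
  { AddGroup.ofLeftAxioms (G := CocycleExtension f)
      (fun a b c => by
        ext
        · simp only [fiber_add, base_add]
          have := hf.homogenize_cocycle a.base b.base c.base
          rw [← sub_eq_zero] at this ⊢
          rw [← this]
          abel
        · simp [add_assoc])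
      (fun a => by ext <;> simp [hf.homogenize_zero_left])
      (fun a => by ext <;> simp [homogenize_neg_self]) with
    add_comm := fun a b => by
      ext
      · simp [hf.homogenize_comm a.base b.base, add_comm]
      · simp [add_comm] }

/-- Scaling by `t : F`, as an endomorphism of the extension. -/
def scale (hf : IsFourTermSolution f) :
    letI := addCommGroup hf
    F →* AddMonoid.End (CocycleExtension f) :=
  letI := addCommGroup hf
  { toFun := fun t =>
      { toFun := fun m => ⟨t • m.fiber, t * m.base⟩
        map_zero' := by ext <;> simp
        map_add' := fun m n => by ext <;> simp [homogenize_mul, mul_add] }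
    map_one' := AddMonoidHom.ext fun m =>
      CocycleExtension.ext (one_smul F m.fiber) (one_mul m.base)
    map_mul' := fun s t => AddMonoidHom.ext fun m =>
      CocycleExtension.ext (mul_smul s t m.fiber) (mul_assoc s t m.base) }

/-- The defect of additivity sees only the base and lands in the fiber, so it squares to zero. -/
theorem scale_add_scale_sub_scale_add (hf : IsFourTermSolution f) (s t : F)
    (m : CocycleExtension f) :
    letI := addCommGroup hf
    (scale hf s + scale hf t - scale hf (s + t)) m = ⟨m.base • homogenize f s t, 0⟩ := by
  let _ := addCommGroup hf
  change scale hf s m + scale hf t m - scale hf (s + t) m = _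
  rw [sub_eq_iff_eq_add]
  have h : homogenize f (s * m.base) (t * m.base) = m.base • homogenize f s t := by
    rw [← homogenize_mul, mul_comm s, mul_comm t]
  ext
  · simp only [fiber_add, hf.homogenize_zero_left, add_zero]
    change s • m.fiber + t • m.fiber + homogenize f (s * m.base) (t * m.base) =
      m.base • homogenize f s t + (s + t) • m.fiber
    rw [h, add_smul]
    abel
  · simp only [base_add, zero_add]
    exact (add_mul s t m.base).symm

/-- At `n = p` in characteristic `p`, only the cocycle sum survives: it is the obstruction to `p`
killing the extension. -/
theorem nsmul_eq (hf : IsFourTermSolution f) (n : ℕ) (m : CocycleExtension f) :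
    letI := addCommGroup hf
    n • m = ⟨n • m.fiber + m.base • ∑ k ∈ Finset.range n, homogenize f (k : F) 1,
      n * m.base⟩ := by
  let _ := addCommGroup hf
  induction n with
  | zero => rw [zero_nsmul]; ext <;> simp
  | succ n ih =>
    rw [succ_nsmul, ih]
    ext
    · have : homogenize f (n * m.base) m.base = m.base • homogenize f (n : F) 1 := by
        rw [← homogenize_mul, mul_one, mul_comm]
      simp only [fiber_add, this, Finset.sum_range_succ, smul_add, succ_nsmul]
      abel
    · simp only [base_add, Nat.cast_succ]; ring

end CocycleExtension

/-! ### Vanishing of solutions by Frobenius in the endomorphism ring -/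

/-- Over a perfect field of characteristic `p`, a solution of the four-term equation whose
extension is killed by `p` is zero. -/
theorem IsFourTermSolution.eq_zero {F V : Type*} [Field F] [AddCommGroup V] [Module F V]
    {f : F → V} (hf : IsFourTermSolution f) (p : ℕ) [hp : Fact p.Prime] [CharP F p]
    [PerfectRing F p] (hc : ∑ k ∈ Finset.range p, homogenize f (k : F) 1 = 0) (a : F) :
    f a = 0 := by
  let _ := CocycleExtension.addCommGroup hf
  have hpE : ∀ m : CocycleExtension f, p • m = 0 := fun m => by
    rw [CocycleExtension.nsmul_eq, hc]
    ext
    · simp [← Nat.cast_smul_eq_nsmul F]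
    · simp
  let e : CocycleExtension f := ⟨0, 1⟩
  have he : e ≠ 0 := fun h => one_ne_zero (congrArg CocycleExtension.base h)
  have : Nontrivial (AddMonoid.End (CocycleExtension f)) :=
    ⟨1, 0, fun h => he (DFunLike.congr_fun h e)⟩
  have : CharP (AddMonoid.End (CocycleExtension f)) p := by
    refine (CharP.charP_iff_prime_eq_zero hp.out).2 (AddMonoidHom.ext fun m => ?_)
    rw [← nsmul_one]
    exact hpE m
  let ρ := CocycleExtension.scale hf
  obtain ⟨u, hu⟩ := surjective_frobenius F p a
  obtain ⟨v, hv⟩ := surjective_frobenius F p (1 - a)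
  have huv : (u + v) ^ p = 1 := by
    rw [add_pow_char, ← frobenius_def, ← frobenius_def, hu, hv]; ring
  have hcomm : ∀ s t, Commute (ρ s) (ρ t) := fun s t => (Commute.all s t).map ρ
  have hN := CocycleExtension.scale_add_scale_sub_scale_add hf u v
  have hN2 : (ρ u + ρ v - ρ (u + v)) ^ 2 = 0 := AddMonoidHom.ext fun m => by
    rw [pow_two]
    change (ρ u + ρ v - ρ (u + v)) ((ρ u + ρ v - ρ (u + v)) m) = 0
    rw [hN, hN, zero_smul]
    rfl
  -- This is the `p`-th power of the defect at the `p`-th roots `u`, `v`, and `p ≥ 2`.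
  have hNp : ρ a + ρ (1 - a) - ρ (a + (1 - a)) = 0 := by
    rw [← pow_eq_zero_of_le hp.out.two_le hN2,
      sub_pow_char_of_commute p ((hcomm _ _).add_left (hcomm _ _)),
      add_pow_char_of_commute p (hcomm _ _), ← map_pow, ← map_pow, ← map_pow, huv,
      ← frobenius_def, ← frobenius_def, hu, hv, add_sub_cancel]
  -- At the element of base `1`, the fiber of the defect is `f a` itself, since `a + (1 - a) = 1`.
  have h := CocycleExtension.scale_add_scale_sub_scale_add hf a (1 - a) e
  change (ρ a + ρ (1 - a) - ρ (a + (1 - a))) e = _ at h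
  rw [hNp] at h
  simpa [e, homogenize] using (congrArg CocycleExtension.fiber h).symm

/-! ### The quotient of `(x + y) ^ p - x ^ p - y ^ p` by `p` -/

/-- The value at `(x, y)` of the integral polynomial `((X + Y) ^ p - X ^ p - Y ^ p) / p`. -/
def frobeniusDefect {R : Type*} [CommRing R] (p : ℕ) (x y : R) : R :=
  ∑ k ∈ Finset.Ioo 0 p, x ^ k * y ^ (p - k) * ((p.choose k / p : ℕ) : R)

theorem mul_frobeniusDefect {R : Type*} [CommRing R] {p : ℕ} (hp : p.Prime) (x y : R) :
    p * frobeniusDefect p x y = (x + y) ^ p - x ^ p - y ^ p := by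
  rw [add_pow_prime_eq' hp, frobeniusDefect]
  ring

theorem map_frobeniusDefect {R S : Type*} [CommRing R] [CommRing S] (φ : R →+* S) (p : ℕ)
    (x y : R) : φ (frobeniusDefect p x y) = frobeniusDefect p (φ x) (φ y) := by
  simp [frobeniusDefect]

theorem mul_pow_frobeniusDefect {R : Type*} [CommRing R] (p : ℕ) (t x y : R) :
    t ^ p * frobeniusDefect p x y = frobeniusDefect p (t * x) (t * y) := by
  rw [frobeniusDefect, frobeniusDefect, Finset.mul_sum]
  refine Finset.sum_congr rfl fun k hk => ?_
  rw [mul_pow, mul_pow, ← Nat.add_sub_of_le (Finset.mem_Ioo.1 hk).2.le, pow_add,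
    Nat.add_sub_cancel_left]
  ring

theorem frobeniusDefect_zero_left {R : Type*} [CommRing R] (p : ℕ) (y : R) :
    frobeniusDefect p 0 y = 0 :=
  Finset.sum_eq_zero fun k hk => by simp [zero_pow (Finset.mem_Ioo.1 hk).1.ne']

theorem frobeniusDefect_zero_right {R : Type*} [CommRing R] (p : ℕ) (x : R) :
    frobeniusDefect p x 0 = 0 :=
  Finset.sum_eq_zero fun k hk => by simp [zero_pow (Nat.sub_pos_of_lt (Finset.mem_Ioo.1 hk).2).ne']

/-- After multiplication by `p` all powers cancel, `p` being odd. Cancelling `p` is legitimate over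
`ℤ[X, Y]`, from which the identity specializes. -/
theorem frobeniusDefect_four_term {R : Type*} [CommRing R] {p : ℕ} (hp : p.Prime) (hp2 : p ≠ 2)
    (a b : R) :
    frobeniusDefect p a (1 - a) - frobeniusDefect p b (1 - b) + frobeniusDefect p b (a - b)
      + frobeniusDefect p (1 - b) (b - a) = 0 := by
  have key : ∀ x y : MvPolynomial (Fin 2) ℤ,
      frobeniusDefect p x (1 - x) - frobeniusDefect p y (1 - y) + frobeniusDefect p y (x - y)
        + frobeniusDefect p (1 - y) (y - x) = 0 := fun x y => by
    have hp0 : (p : MvPolynomial (Fin 2) ℤ) ≠ 0 := Nat.cast_ne_zero.2 hp.ne_zero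
    refine (mul_eq_zero.1 ?_).resolve_left hp0
    have hodd : (y - x) ^ p = -(x - y) ^ p := by
      rw [← neg_sub x y, (hp.odd_of_ne_two hp2).neg_pow]
    rw [mul_add, mul_add, mul_sub, mul_frobeniusDefect hp, mul_frobeniusDefect hp,
      mul_frobeniusDefect hp, mul_frobeniusDefect hp, hodd, add_sub_cancel,
      add_sub_cancel, add_sub_cancel, sub_add_sub_cancel]
    ring
  have h := congrArg (MvPolynomial.aeval ![a, b] : MvPolynomial (Fin 2) ℤ →ₐ[ℤ] R).toRingHom
    (key (MvPolynomial.X 0) (MvPolynomial.X 1))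
  simpa only [map_add, map_sub, map_frobeniusDefect, map_one, map_zero, AlgHom.toRingHom_eq_coe,
    RingHom.coe_coe, MvPolynomial.aeval_X, Matrix.cons_val_zero, Matrix.cons_val_one] using h

/-- If all values vanished, those at integers would be divisible by `p`, forcing `n ^ p ≡ n` modulo
`p ^ 2` by induction on `n`; this fails at `n = p`. -/
theorem exists_frobeniusDefect_ne_zero (F : Type*) [Field F] {p : ℕ} (hp : p.Prime)
    (hp2 : p ≠ 2) [CharP F p] :
    ∃ a : F, a ≠ 0 ∧ a ≠ 1 ∧ frobeniusDefect p a (1 - a) ≠ 0 := by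
  by_contra! H
  have h0 : ∀ a : F, frobeniusDefect p a (1 - a) = 0 := fun a => by
    by_cases a0 : a = 0
    · rw [a0, frobeniusDefect_zero_left]
    by_cases a1 : a = 1
    · rw [a1, sub_self, frobeniusDefect_zero_right]
    exact H a a0 a1
  have hdvd : ∀ n : ℤ, (p : ℤ) * p ∣ 1 - n ^ p - (1 - n) ^ p := fun n => by
    have h : (p : ℤ) ∣ frobeniusDefect p n (1 - n) := by
      rw [← CharP.intCast_eq_zero_iff F p, ← eq_intCast (Int.castRingHom F),
        map_frobeniusDefect]
      simpa using h0 n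
    have := mul_dvd_mul_left (p : ℤ) h
    rwa [mul_frobeniusDefect hp, add_sub_cancel, one_pow] at this
  have hfermat : ∀ n : ℕ, (p : ℤ) * p ∣ (n : ℤ) ^ p - n := fun n => by
    induction n with
    | zero => simp [hp.ne_zero]
    | succ n ih =>
      have h := hdvd (n + 1)
      rw [show (1 : ℤ) - (n + 1) = -n by ring, (hp.odd_of_ne_two hp2).neg_pow] at h
      have e : ((n + 1 : ℕ) : ℤ) ^ p - (n + 1 : ℕ) =
          (n : ℤ) ^ p - n - (1 - (n + 1) ^ p - -(n : ℤ) ^ p) := by push_cast; ring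
      rw [e]
      exact dvd_sub ih h
  have hpp : (p : ℤ) * p ∣ (p : ℤ) := by
    have h1 : (p : ℤ) * p ∣ (p : ℤ) ^ p := by
      rw [← pow_two]; exact pow_dvd_pow _ hp.two_le
    simpa using dvd_sub h1 (hfermat p)
  have : p * p ∣ p := by exact_mod_cast hpp
  have := Nat.le_of_dvd hp.pos this
  nlinarith [hp.two_le]

/-! ### The space `𝔟₂(F)` -/

/-- In odd characteristic `p`, the space `𝔟₂(F)` is nontrivial: the `p`-th root of
`frobeniusDefect p a (1 - a)` defines a nonzero linear map from it to an algebraic closure. -/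
theorem B2.nontrivial (F : Type*) [Field F] {p : ℕ} (hp : p.Prime) (hp2 : p ≠ 2) [CharP F p] :
    Nontrivial (B2 F) := by
  have : Fact p.Prime := ⟨hp⟩
  let K := AlgebraicClosure F
  have : CharP K p := charP_of_injective_algebraMap (algebraMap F K).injective p
  let g : DoublyPunctured F → K := fun a =>
    (frobeniusEquiv K p).symm (algebraMap F K (frobeniusDefect p (a : F) (1 - a)))
  have hg : ∀ a, g a ^ p = algebraMap F K (frobeniusDefect p (a : F) (1 - a)) := fun a =>
    frobeniusEquiv_symm_pow_p K p _
  let φ : (DoublyPunctured F →₀ F) →ₗ[F] K := Finsupp.linearCombination F g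
  have hφ : fourTermRelations F ≤ LinearMap.ker φ := by
    refine Submodule.span_le.2 ?_
    rintro _ ⟨a, b, h, rfl⟩
    have a0 : (a : F) ≠ 0 := a.2.1
    have a1 : 1 - (a : F) ≠ 0 := sub_ne_zero.2 a.2.2.symm
    rw [SetLike.mem_coe, LinearMap.mem_ker]
    simp only [fourTerm, map_add, map_sub, map_smul, φ, Finsupp.linearCombination_single, one_smul]
    -- On `p`-th powers the coefficients become `a ^ p` and `(1 - a) ^ p`, which degree-`p`
    -- homogeneity absorbs, clearing the denominators.
    apply frobenius_inj K p
    simp only [map_add, map_sub, map_zero, Algebra.smul_def, map_mul, frobenius_def, hg]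
    simp only [← map_pow, ← map_mul, ← map_add, ← map_sub, mul_pow_frobeniusDefect,
      DoublyPunctured.quot, DoublyPunctured.coquot]
    have hs : 1 ^ p - (a : F) ^ p = (1 - a) ^ p := (sub_pow_char 1 (a : F)).symm
    rw [hs, mul_pow_frobeniusDefect, mul_sub, mul_div_cancel₀ _ a0, mul_sub, mul_div_cancel₀ _ a1, mul_one, mul_one,
      show 1 - (a : F) - (1 - b) = b - a by ring, frobeniusDefect_four_term hp hp2, map_zero]
  obtain ⟨a, a0, a1, ha⟩ := exists_frobeniusDefect_ne_zero F hp hp2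
  refine ⟨Submodule.Quotient.mk (Finsupp.single ⟨a, a0, a1⟩ 1), 0, fun h => ha ?_⟩
  have h1 := hφ ((Submodule.Quotient.mk_eq_zero _).1 h)
  rw [LinearMap.mem_ker, Finsupp.linearCombination_single, one_smul] at h1
  have h2 := hg ⟨a, a0, a1⟩
  rw [h1, zero_pow hp.ne_zero, eq_comm, map_eq_zero] at h2
  exact h2

/-! ### The universal solution and generation by one class -/

/-- The class `⟨a⟩` in `𝔟₂(F)`, extended by zero to `a = 0, 1`. -/
noncomputable def B2.symbol {F : Type*} [Field F] (a : F) : B2 F :=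
  open Classical in
  if h : a ≠ 0 ∧ a ≠ 1 then Submodule.Quotient.mk (Finsupp.single ⟨a, h⟩ 1) else 0

theorem B2.symbol_coe {F : Type*} [Field F] (a : DoublyPunctured F) :
    B2.symbol (a : F) = Submodule.Quotient.mk (Finsupp.single a 1) :=
  dif_pos a.2

theorem B2.isFourTermSolution_symbol {F : Type*} [Field F] (h2 : (2 : F) ≠ 0) :
    IsFourTermSolution (B2.symbol (F := F)) := by
  refine .of_generic h2 (by simp [symbol]) (by simp [symbol]) fun a b a0 a1 b0 b1 hab => ?_
  let a' : DoublyPunctured F := ⟨a, a0, a1⟩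
  let b' : DoublyPunctured F := ⟨b, b0, b1⟩
  have h : a' ≠ b' := fun e => hab (congrArg Subtype.val e)
  have hr : fourTerm a' b' h ∈ fourTermRelations F := Submodule.subset_span ⟨a', b', h, rfl⟩
  have := (Submodule.Quotient.mk_eq_zero _).2 hr
  simp only [fourTerm, Submodule.Quotient.mk_add, Submodule.Quotient.mk_sub,
    Submodule.Quotient.mk_smul, ← B2.symbol_coe] at this
  exact this

theorem B2.span_range_symbol (F : Type*) [Field F] :
    Submodule.span F (Set.range (B2.symbol (F := F))) = ⊤ := by
  refine eq_top_iff.2 fun v _ => ?_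
  obtain ⟨w, rfl⟩ := Submodule.Quotient.mk_surjective _ v
  induction w using Finsupp.induction_linear with
  | zero => exact Submodule.zero_mem _
  | add x y hx hy => exact Submodule.add_mem _ (hx trivial) (hy trivial)
  | single a r =>
    rw [← mul_one r, ← smul_eq_mul, ← Finsupp.smul_single, Submodule.Quotient.mk_smul,
      ← B2.symbol_coe]
    exact Submodule.smul_mem _ _ (Submodule.subset_span ⟨_, rfl⟩)

theorem homogenize_comp {F V W : Type*} [Field F] [AddCommGroup V] [Module F V]
    [AddCommGroup W] [Module F W] (f : F → V) (φ : V →ₗ[F] W) (x y : F) :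
    homogenize (fun a => φ (f a)) x y = φ (homogenize f x y) :=
  (map_smul φ _ _).symm

theorem IsFourTermSolution.comp {F V W : Type*} [Field F] [AddCommGroup V] [Module F V]
    [AddCommGroup W] [Module F W] {f : F → V} (hf : IsFourTermSolution f) (φ : V →ₗ[F] W) :
    IsFourTermSolution (fun a => φ (f a)) where
  zero := by rw [hf.zero, map_zero]
  one_sub a := by rw [hf.one_sub]
  inv a := by rw [← map_smul, hf.inv, map_neg]
  fourTerm a b := by
    simp only [← map_smul, ← map_add, ← map_sub, hf.fourTerm, map_zero]

/-- Over a perfect field of odd characteristic, `𝔟₂(F)` is spanned by a single element. -/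
theorem B2.exists_span_singleton_eq_top (F : Type*) [Field F] (p : ℕ) [Fact p.Prime]
    [CharP F p] [PerfectRing F p] (h2 : (2 : F) ≠ 0) :
    ∃ c : B2 F, Submodule.span F {c} = ⊤ := by
  have hf := B2.isFourTermSolution_symbol h2
  refine ⟨∑ k ∈ Finset.range p, homogenize B2.symbol (k : F) 1, ?_⟩
  set c := ∑ k ∈ Finset.range p, homogenize B2.symbol (k : F) 1
  -- Modulo `c` the obstruction vanishes, so every symbol dies in the quotient.
  have hq := (hf.comp (Submodule.span F {c}).mkQ).eq_zero p (by
    simp only [homogenize_comp, ← map_sum]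
    exact (Submodule.Quotient.mk_eq_zero _).2 (Submodule.mem_span_singleton_self c))
  rw [eq_top_iff, ← B2.span_range_symbol, Submodule.span_le]
  rintro _ ⟨a, rfl⟩
  exact (Submodule.Quotient.mk_eq_zero _).1 (hq a)

theorem corollary4p10 {F : Type*} [Field F] (p : ℕ) (hp : p.Prime) (hp2 : p ≠ 2) [CharP F p] :
    1 ≤ Module.rank F (B2 F) ∧ (PerfectField F → Nonempty (B2 F ≃ₗ[F] F)) := by
  have : Fact p.Prime := ⟨hp⟩
  have := B2.nontrivial F hp hp2
  refine ⟨Cardinal.one_le_iff_pos.2 rank_pos, fun _ => ?_⟩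
  obtain ⟨c, hc⟩ := B2.exists_span_singleton_eq_top F p (Ring.two_ne_zero (by
    rwa [ringChar.eq F p]))
  have hc0 : c ≠ 0 := by
    rintro rfl
    rw [Submodule.span_zero_singleton] at hc
    exact bot_ne_top hc
  exact ⟨((LinearEquiv.toSpanNonzeroSingleton F (B2 F) c hc0).trans
    (LinearEquiv.ofTop _ hc)).symm⟩
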